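/- Let $L\ge 0$ be an even integer and let $c_1,\dots,c_L$ be the fermionic annihilation operators of $L$ sites, acting on the $2^L$-dimensional Fock space and satisfying $\{c_i,c_j\}=0$, $\{c_i,c_j^\dagger\}=\delta_{ij}$. Let $N_w=\sum_{j=1}^L c_j^\dagger c_j$ be the particle number operator. Let $h,\Delta$ be complex $L\times L$ matrices with $h$ Hermitian, and consider the mean-field superconducting Hamiltonian $$H=\sum_{i,j=1}^L\Big(h_{ij}\,c_i^\dagger c_j+\tfrac12\Delta_{ij}\,c_i^\dagger c_j^\dagger+\tfrac12\overline{\Delta_{ij}}\,c_jc_i\Big).$$ Let $u,v$ be complex $L\times L$ matrices and $E_1,\dots,E_L\ge 0$ real numbers such that the quasiparticle operators $d_i=\sum_{j=1}^L(u_{ij}c_j+v_{ij}c_j^\dagger)$ diagonalize $H$, i.e. $[H,d_i]=-E_id_i$, $\{d_i,d_j\}=0$ and $\{d_i,d_j^\dagger\}=\delta_{ij}$ for all $i,j$. Let $|+\rangle$ be the BCS ground state defined by the $d_i$, i.e. a unit vector with $d_i|+\rangle=0$ for all $i$. Then, with $\overline N_{w,+}=\langle +|N_w|+\rangle$, $$\langle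 +|(N_w-\overline N_{w,+})^2|+\rangle\le\frac L2 .$$ Moreover, if $i_1$ is an index at which the energy is lowest ($E_{i_1}\le E_i$ for all $i$), then the state $|-\rangle=d_{i_1}^\dagger|+\rangle$ is a unit vector and, with $\overline N_{w,-}=\langle -|N_w|-\rangle$, $$\langle -|(N_w-\overline N_{w,-})^2|-\rangle\le\frac L2+8 .$$ (In the usual convention $|+\rangle$ is the even-parity and $|-\rangle$ the odd-parity ground state; the bounds hold whatever the fermion parity of $|+\rangle$ is.) -/

import Mathlib

noncomputable section

namespace MeanFieldSC

/-- The fermionic Fock space of `L` sites: the Hilbert space with orthonormal basis `|S⟩`, one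
basis vector for each set `S` of occupied sites.  The vector `|S⟩` stands for
`c†_{j₁} c†_{j₂} ⋯ c†_{jₖ} |0⟩`, where `S = {j₁ < j₂ < ⋯ < jₖ}`. -/
abbrev Fock (L : ℕ) : Type := EuclideanSpace ℂ (Finset (Fin L))

/-- The operator `c_j` that annihilates a fermion at site `j`: it sends `|S⟩` to
`(-1)^{#{k ∈ S : k < j}} |S \ {j}⟩` if `j ∈ S`, and to `0` otherwise.  In components,
`(c_j ψ)(S) = (-1)^{#{k ∈ S : k < j}} ψ(S ∪ {j})` if `j ∉ S`, and `(c_j ψ)(S) = 0` if `j ∈ S`. -/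
def annihilation {L : ℕ} (j : Fin L) : Module.End ℂ (Fock L) where
  toFun ψ := WithLp.toLp 2 fun S =>
    if j ∈ S then 0 else (-1) ^ (S.filter (fun k => k < j)).card * ψ (insert j S)
  map_add' φ ψ := by
    ext S
    by_cases hj : j ∈ S <;> simp [hj, mul_add]
  map_smul' a ψ := by
    ext S
    by_cases hj : j ∈ S <;> simp [hj, mul_left_comm]

/-- The operator `c†_j` that creates a fermion at site `j`: the adjoint of `c_j`. -/
def creation {L : ℕ} (j : Fin L) : Module.End ℂ (Fock L) :=
  LinearMap.adjoint (annihilation j)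

/-- The particle number operator `N_w = ∑_j c†_j c_j`. -/
def numberOp (L : ℕ) : Module.End ℂ (Fock L) :=
  ∑ j : Fin L, creation j * annihilation j

/-- The quadratic mean-field Hamiltonian
`∑_{i,j} (h_{ij} c†_i c_j + ½ Δ_{ij} c†_i c†_j + ½ conj(Δ_{ij}) c_j c_i)`. -/
def hamiltonian {L : ℕ} (h Δ : Matrix (Fin L) (Fin L) ℂ) : Module.End ℂ (Fock L) :=
  ∑ i : Fin L, ∑ j : Fin L,
    (h i j • (creation i * annihilation j) + (1 / 2 * Δ i j) • (creation i * creation j)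
      + (1 / 2 * (starRingEnd ℂ) (Δ i j)) • (annihilation j * annihilation i))

/-- The operator `d_i = ∑_j (u_{ij} c_j + v_{ij} c†_j)`. -/
def quasiparticle {L : ℕ} (u v : Matrix (Fin L) (Fin L) ℂ) (i : Fin L) :
    Module.End ℂ (Fock L) :=
  ∑ j : Fin L, (u i j • annihilation j + v i j • creation j)

/-- The operators `d_i` determined by `u` and `v` are quasiparticle lowering operators that
diagonalize the mean-field Hamiltonian with energies `E_i ≥ 0`: they satisfy
`[H, d_i] = -E_i d_i` and the canonical anticommutation relations. -/
structure IsDiagonalizedBy {L : ℕ} (h Δ u v : Matrix (Fin L) (Fin L) ℂ) (E : Fin L → ℝ) :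
    Prop where
  energy_nonneg : ∀ i, 0 ≤ E i
  commutator : ∀ i,
    hamiltonian h Δ * quasiparticle u v i - quasiparticle u v i * hamiltonian h Δ
      = -((E i : ℂ) • quasiparticle u v i)
  anticomm : ∀ i j,
    quasiparticle u v i * quasiparticle u v j + quasiparticle u v j * quasiparticle u v i = 0
  anticomm_adjoint : ∀ i j,
    quasiparticle u v i * LinearMap.adjoint (quasiparticle u v j)
      + LinearMap.adjoint (quasiparticle u v j) * quasiparticle u v i = if i = j then 1 else 0

/-- The expectation value `⟨ψ|A|ψ⟩` of an observable `A` in the state `ψ`.  It is used only for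
self-adjoint `A`, for which `⟨ψ|A|ψ⟩` is real. -/
def expectation {L : ℕ} (A : Module.End ℂ (Fock L)) (ψ : Fock L) : ℝ :=
  (inner ℂ ψ (A ψ)).re

/-- The variance `⟨ψ|(N_w - ⟨ψ|N_w|ψ⟩)²|ψ⟩` of the particle number in the state `ψ`. -/
def numberVariance {L : ℕ} (ψ : Fock L) : ℝ :=
  expectation ((numberOp L - ((expectation (numberOp L) ψ : ℝ) : ℂ) • 1) ^ 2) ψ

end MeanFieldSC

end

namespace MeanFieldSC

open scoped Matrix

variable {L : ℕ}

/-! The anticommutation relations of the `d_i` say that the Bogoliubov matrix built from `u` and `v`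
is unitary. Inverting it and normal ordering `N_w` gives, on a vacuum ψ of the `d_i`, `N_w ψ = ‖v‖²
ψ + ∑ A_ik d†_i d†_k ψ` with Frobenius norm and `A = u vᵀ` antisymmetric (`numberOp_apply`). The
pair states are orthogonal to ψ, so the variance is the squared norm of the pair term, which is
`2‖A‖²` (`norm_sum_pair_sq`). With `P = u uᴴ`, unitarity gives `A Aᴴ = P - P²`, whose trace is `L/4
- ‖P - 1/2‖² ≤ L/4` (`sum_norm_mul_transpose_sq_le`). Hence the bound `L/2`. The state `d†_a ψ` is
itself a vacuum, of the operators obtained by exchanging `d_a` with `d†_a`; these satisfy the same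
relations, so the same bound applies to it. -/

/-- The explicit action of the creation operator in the occupation basis. -/
def explicitCreation (j : Fin L) : Module.End ℂ (Fock L) where
  toFun ψ := WithLp.toLp 2 fun S =>
    if j ∈ S then (-1) ^ (S.filter (fun k => k < j)).card * ψ (S.erase j) else 0
  map_add' φ ψ := by
    ext S
    by_cases hj : j ∈ S <;> simp [hj, mul_add]
  map_smul' a ψ := by
    ext S
    by_cases hj : j ∈ S <;> simp [hj, mul_left_comm]

lemma filter_lt_erase_self (j : Fin L) (S : Finset (Fin L)) :
    (S.erase j).filter (fun k => k < j) = S.filter (fun k => k < j) := by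
  ext k
  simp only [Finset.mem_filter, Finset.mem_erase]
  exact ⟨fun h => ⟨h.1.2, h.2⟩, fun h => ⟨⟨h.2.ne, h.1⟩, h.2⟩⟩

lemma filter_lt_insert_self (j : Fin L) (S : Finset (Fin L)) :
    (insert j S).filter (fun k => k < j) = S.filter (fun k => k < j) := by
  simp [Finset.filter_insert]

lemma creation_eq (j : Fin L) : creation j = explicitCreation j := by
  symm
  unfold creation
  rw [LinearMap.eq_adjoint_iff]
  intro x y
  simp only [PiLp.inner_apply]
  have h1 : ∀ S : Finset (Fin L), inner ℂ (explicitCreation j x S) (y S) =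
      if j ∈ S then
        (-1) ^ (S.filter (fun k => k < j)).card * inner ℂ (x (S.erase j)) (y S) else 0 := by
    intro S
    by_cases hj : j ∈ S <;> simp [explicitCreation, hj]
    ring
  have h2 : ∀ S : Finset (Fin L), inner ℂ (x S) (annihilation j y S) =
      if j ∉ S then
        (-1) ^ (S.filter (fun k => k < j)).card * inner ℂ (x S) (y (insert j S)) else 0 := by
    intro S
    by_cases hj : j ∈ S <;> simp [annihilation, hj]
    ring
  rw [Finset.sum_congr rfl fun S _ => h1 S, Finset.sum_congr rfl fun S _ => h2 S,
    ← Finset.sum_filter, ← Finset.sum_filter]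
  refine Finset.sum_nbij' (fun S => S.erase j) (fun S => insert j S) ?_ ?_ ?_ ?_ ?_
  · intro S _; simp
  · intro S _; simp
  · intro S hS; exact Finset.insert_erase (Finset.mem_filter.1 hS).2
  · intro S hS; exact Finset.erase_insert (Finset.mem_filter.1 hS).2
  · intro S hS
    rw [filter_lt_erase_self, Finset.insert_erase (Finset.mem_filter.1 hS).2]

lemma creation_apply (j : Fin L) (ψ : Fock L) (S : Finset (Fin L)) :
    creation j ψ S =
      if j ∈ S then (-1) ^ (S.filter (fun k => k < j)).card * ψ (S.erase j) else 0 := by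
  rw [creation_eq]; rfl

/-! ### Jordan–Wigner signs and anticommutation relations -/

/-- The Jordan–Wigner sign of site `j` in the configuration `S`. -/
def jwSign (S : Finset (Fin L)) (j : Fin L) : ℂ := (-1) ^ (S.filter (fun k => k < j)).card

lemma jwSign_mul_self (S : Finset (Fin L)) (j : Fin L) : jwSign S j * jwSign S j = 1 := by
  rw [jwSign, ← mul_pow]; simp

lemma jwSign_insert_self (S : Finset (Fin L)) (j : Fin L) :
    jwSign (insert j S) j = jwSign S j := by
  rw [jwSign, filter_lt_insert_self, jwSign]

lemma jwSign_erase_self (S : Finset (Fin L)) (j : Fin L) :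
    jwSign (S.erase j) j = jwSign S j := by
  rw [jwSign, filter_lt_erase_self, jwSign]

/-- Only sites to the left of `j` count. For `i ≠ j`, exactly one of the two orders of a product
therefore picks up an extra sign, which is why the operators anticommute. -/
lemma jwSign_insert {S : Finset (Fin L)} {i : Fin L} (hi : i ∉ S) (j : Fin L) :
    jwSign (insert i S) j = if i < j then -jwSign S j else jwSign S j := by
  unfold jwSign
  rw [Finset.filter_insert]
  split_ifs with h
  · rw [Finset.card_insert_of_notMem (by simp [hi]), pow_succ]; ring
  · rfl

lemma jwSign_erase {S : Finset (Fin L)} {i : Fin L} (hi : i ∈ S) (j : Fin L) :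
    jwSign (S.erase i) j = if i < j then -jwSign S j else jwSign S j := by
  have := jwSign_insert (Finset.notMem_erase i S) j
  rw [Finset.insert_erase hi] at this
  split_ifs with h <;> simp [this, h]

lemma annihilation_apply_jwSign (j : Fin L) (ψ : Fock L) (S : Finset (Fin L)) :
    annihilation j ψ S = if j ∈ S then 0 else jwSign S j * ψ (insert j S) := rfl

lemma creation_apply_jwSign (j : Fin L) (ψ : Fock L) (S : Finset (Fin L)) :
    creation j ψ S = if j ∈ S then jwSign S j * ψ (S.erase j) else 0 :=
  creation_apply j ψ S

lemma annihilation_anticomm (i j : Fin L) :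
    annihilation i * annihilation j + annihilation j * annihilation i = 0 := by
  ext1 ψ
  ext S
  simp only [LinearMap.add_apply, Module.End.mul_apply, PiLp.add_apply,
    annihilation_apply_jwSign, LinearMap.zero_apply, PiLp.zero_apply, Finset.mem_insert]
  by_cases hij : i = j
  · subst hij; simp
  by_cases hi : i ∈ S
  · simp [hi]
  by_cases hj : j ∈ S
  · simp [hj]
  simp only [hi, hj, hij, Ne.symm hij, if_false, or_false, jwSign_insert hi, jwSign_insert hj,
    Finset.insert_comm j i S]
  rcases lt_or_gt_of_ne hij with h | h
  · simp only [h, h.not_gt, if_true, if_false]; ring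
  · simp only [h, h.not_gt, if_true, if_false]; ring

lemma annihilation_anticomm_creation (i j : Fin L) :
    annihilation i * creation j + creation j * annihilation i = if i = j then 1 else 0 := by
  ext1 ψ
  ext S
  simp only [LinearMap.add_apply, Module.End.mul_apply, PiLp.add_apply,
    annihilation_apply_jwSign, creation_apply_jwSign, Finset.mem_insert, Finset.mem_erase]
  by_cases hij : i = j
  · subst hij
    by_cases hi : i ∈ S
    · simp [hi, jwSign_erase_self, ← mul_assoc, jwSign_mul_self]
    · simp [hi, jwSign_insert_self, ← mul_assoc, jwSign_mul_self]
  by_cases hi : i ∈ S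
  · simp [hi, hij]
  by_cases hj : j ∈ S
  · simp only [hi, hj, hij, Ne.symm hij, if_false, or_true, if_true, and_false, jwSign_insert hi,
      jwSign_erase hj, Finset.erase_insert_of_ne hij]
    rcases lt_or_gt_of_ne hij with h | h
    · simp only [h, h.not_gt, if_true, if_false, LinearMap.zero_apply, PiLp.zero_apply]; ring
    · simp only [h, h.not_gt, if_true, if_false, LinearMap.zero_apply, PiLp.zero_apply]; ring
  · simp [hj, hij, Ne.symm hij]

lemma star_annihilation (j : Fin L) : star (annihilation j) = creation j := rfl

lemma star_creation (j : Fin L) : star (creation j) = annihilation j := by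
  rw [← star_annihilation, star_star]

lemma creation_anticomm (i j : Fin L) :
    creation i * creation j + creation j * creation i = 0 := by
  have := congrArg star (annihilation_anticomm j i)
  simpa [star_annihilation] using this

lemma star_quasiparticle (u v : Matrix (Fin L) (Fin L) ℂ) (i : Fin L) :
    star (quasiparticle u v i) = quasiparticle (v.map star) (u.map star) i := by
  simp [quasiparticle, star_sum, star_annihilation, star_creation, add_comm]

/-- Two independent coefficient pairs are allowed so that adjoints, which have the same form by
`star_quasiparticle`, are covered too. -/
lemma quasiparticle_anticomm (u v u' v' : Matrix (Fin L) (Fin L) ℂ) (i j : Fin L) :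
    quasiparticle u v i * quasiparticle u' v' j + quasiparticle u' v' j * quasiparticle u v i =
      (∑ k, (u i k * v' j k + v i k * u' j k)) • (1 : Module.End ℂ (Fock L)) := by
  have key : ∀ k l : Fin L,
      (u i k • annihilation k + v i k • creation k) *
          (u' j l • annihilation l + v' j l • creation l) +
        (u' j l • annihilation l + v' j l • creation l) *
          (u i k • annihilation k + v i k • creation k) =
      if k = l then (u i k * v' j l + v i k * u' j l) • (1 : Module.End ℂ (Fock L)) else 0 := by
    intro k l
    have e : (u i k • annihilation k + v i k • creation k) *
          (u' j l • annihilation l + v' j l • creation l) +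
        (u' j l • annihilation l + v' j l • creation l) *
          (u i k • annihilation k + v i k • creation k) =
        (u i k * u' j l) • (annihilation k * annihilation l + annihilation l * annihilation k) +
        (u i k * v' j l) • (annihilation k * creation l + creation l * annihilation k) +
        (v i k * u' j l) • (annihilation l * creation k + creation k * annihilation l) +
        (v i k * v' j l) • (creation k * creation l + creation l * creation k) := by
      simp only [mul_add, add_mul, smul_mul_smul_comm, smul_add]
      simp only [mul_comm (u' j l), mul_comm (v' j l)]
      abel
    rw [e, annihilation_anticomm, creation_anticomm, annihilation_anticomm_creation,
      annihilation_anticomm_creation]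
    by_cases h : k = l
    · simp [h, add_smul]
    · simp [h, Ne.symm h]
  unfold quasiparticle
  rw [Finset.sum_mul_sum, Finset.sum_mul_sum, Finset.sum_comm (s := Finset.univ (α := Fin L))
    (f := fun l k => (u' j l • annihilation l + v' j l • creation l) *
          (u i k • annihilation k + v i k • creation k))]
  rw [← Finset.sum_add_distrib, Finset.sum_smul]
  refine Finset.sum_congr rfl fun k _ => ?_
  rw [← Finset.sum_add_distrib, Finset.sum_congr rfl fun l _ => key k l]
  simp

/-! ### Unitarity of the Bogoliubov matrix -/

/-- The operators `quasiparticle u v i` satisfy the canonical anticommutation relations. -/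
structure IsCAR (u v : Matrix (Fin L) (Fin L) ℂ) : Prop where
  anticomm : ∀ i j,
    quasiparticle u v i * quasiparticle u v j + quasiparticle u v j * quasiparticle u v i = 0
  anticomm_star : ∀ i j,
    quasiparticle u v i * star (quasiparticle u v j)
      + star (quasiparticle u v j) * quasiparticle u v i = if i = j then 1 else 0

namespace IsCAR

variable {u v : Matrix (Fin L) (Fin L) ℂ}

lemma mul_transpose (H : IsCAR u v) : u * vᵀ + v * uᵀ = 0 := by
  ext i j
  have := H.anticomm i j
  rw [quasiparticle_anticomm, smul_eq_zero_iff_left one_ne_zero] at this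
  simpa [Matrix.mul_apply, Finset.sum_add_distrib] using this

lemma mul_conjTranspose (H : IsCAR u v) : u * uᴴ + v * vᴴ = 1 := by
  ext i j
  have := H.anticomm_star i j
  rw [star_quasiparticle, quasiparticle_anticomm] at this
  have h2 : (∑ k, (u i k * (u.map star) j k + v i k * (v.map star) j k)) =
      if i = j then (1 : ℂ) else 0 := by
    rw [← sub_eq_zero, ← smul_eq_zero_iff_left (one_ne_zero (α := Module.End ℂ (Fock L))),
      sub_smul, this]
    split_ifs <;> simp
  simpa [Matrix.mul_apply, Matrix.one_apply, Finset.sum_add_distrib] using h2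

lemma conj_mul_transpose (H : IsCAR u v) : v.map star * uᴴ + u.map star * vᴴ = 0 := by
  have := congrArg (fun M => Matrix.transpose (Matrix.conjTranspose M)) H.mul_transpose
  ext i j
  have h := congrFun (congrFun this i) j
  simpa [Matrix.mul_apply, mul_comm, add_comm] using h

lemma conj_mul_conjTranspose (H : IsCAR u v) : v.map star * vᵀ + u.map star * uᵀ = 1 := by
  ext i j
  have h := congrFun (congrFun H.mul_conjTranspose j) i
  simpa [Matrix.mul_apply, Matrix.one_apply, mul_comm, add_comm, eq_comm] using h

/-- The second factor is the conjugate transpose of the first, so the four block relations together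
express unitarity. -/
lemma fromBlocks_mul (H : IsCAR u v) :
    Matrix.fromBlocks u v (v.map star) (u.map star) *
      Matrix.fromBlocks uᴴ vᵀ vᴴ uᵀ = 1 := by
  rw [Matrix.fromBlocks_multiply, H.mul_conjTranspose, H.mul_transpose, H.conj_mul_transpose,
    H.conj_mul_conjTranspose, Matrix.fromBlocks_one]

lemma fromBlocks_inv_mul (H : IsCAR u v) :
    Matrix.fromBlocks (uᴴ * u + vᵀ * v.map star) (uᴴ * v + vᵀ * u.map star)
      (vᴴ * u + uᵀ * v.map star) (vᴴ * v + uᵀ * u.map star) = Matrix.fromBlocks 1 0 0 1 := by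
  -- For square matrices a right inverse is also a left inverse; this yields the column relations.
  have := mul_eq_one_comm.1 H.fromBlocks_mul
  rwa [Matrix.fromBlocks_multiply, ← Matrix.fromBlocks_one] at this

lemma conjTranspose_mul (H : IsCAR u v) : uᴴ * u + vᵀ * v.map star = 1 :=
  (Matrix.fromBlocks_inj.1 H.fromBlocks_inv_mul).1

lemma conjTranspose_mul' (H : IsCAR u v) : uᴴ * v + vᵀ * u.map star = 0 :=
  (Matrix.fromBlocks_inj.1 H.fromBlocks_inv_mul).2.1

/-- The inverse Bogoliubov transformation. -/
lemma annihilation_eq (H : IsCAR u v) (j : Fin L) :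
    annihilation j = ∑ i, (star (u i j) • quasiparticle u v i
      + v i j • star (quasiparticle u v i)) := by
  have e1 : ∀ k, ∑ i, (star (u i j) * u i k + v i j * star (v i k)) =
      (1 : Matrix (Fin L) (Fin L) ℂ) j k := by
    intro k
    rw [← H.conjTranspose_mul]
    simp [Matrix.mul_apply, Finset.sum_add_distrib]
  have e2 : ∀ k, ∑ i, (star (u i j) * v i k + v i j * star (u i k)) = 0 := by
    intro k
    have := congrFun (congrFun H.conjTranspose_mul' j) k
    simpa [Matrix.mul_apply, Finset.sum_add_distrib] using this
  have : ∀ i, star (u i j) • quasiparticle u v i + v i j • star (quasiparticle u v i) =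
      ∑ k, ((star (u i j) * u i k + v i j * star (v i k)) • annihilation k +
        (star (u i j) * v i k + v i j * star (u i k)) • creation k) := by
    intro i
    rw [star_quasiparticle]
    unfold quasiparticle
    rw [Finset.smul_sum, Finset.smul_sum, ← Finset.sum_add_distrib]
    refine Finset.sum_congr rfl fun k _ => ?_
    simp only [smul_add, smul_smul, add_smul, Matrix.map_apply]
    abel
  rw [Finset.sum_congr rfl fun i _ => this i, Finset.sum_comm]
  simp only [Finset.sum_add_distrib, ← Finset.sum_smul]
  simp only [← Finset.sum_add_distrib, e1, e2]
  simp [Matrix.one_apply]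

lemma creation_eq (H : IsCAR u v) (j : Fin L) :
    creation j = ∑ i, (u i j • star (quasiparticle u v i)
      + star (v i j) • quasiparticle u v i) := by
  rw [← star_annihilation, H.annihilation_eq j]
  simp [star_sum]

lemma apply_star_apply (H : IsCAR u v) (i j : Fin L) (x : Fock L) :
    quasiparticle u v i (star (quasiparticle u v j) x) =
      (if i = j then x else 0) - star (quasiparticle u v j) (quasiparticle u v i x) := by
  have := congrArg (fun A => A x) (H.anticomm_star i j)
  simp only [LinearMap.add_apply, Module.End.mul_apply] at this
  rw [eq_sub_iff_add_eq, this]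
  split_ifs <;> simp

lemma sum_norm_mul_transpose_sq_le (H : IsCAR u v) :
    ∑ i, ∑ j, ‖(u * vᵀ) i j‖ ^ 2 ≤ (L : ℝ) / 4 := by
  have frob : ∀ M : Matrix (Fin L) (Fin L) ℂ,
      ((∑ i, ∑ j, ‖M i j‖ ^ 2 : ℝ) : ℂ) = (M * Mᴴ).trace := by
    intro M
    simp [Matrix.trace, Matrix.mul_apply, Complex.mul_conj']
  set P := u * uᴴ with hP
  have hvv : vᵀ * (vᵀ)ᴴ = 1 - uᴴ * u := by
    rw [eq_sub_iff_add_eq, ← H.conjTranspose_mul, add_comm]; rfl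
  have e1 : (u * vᵀ) * (u * vᵀ)ᴴ = P - P * P := by
    rw [Matrix.conjTranspose_mul, Matrix.mul_assoc, ← Matrix.mul_assoc vᵀ, hvv, hP]
    noncomm_ring
  have hPH : Pᴴ = P := by simp [hP]
  -- Completing the square: `P - P²` is `1/4` minus this positive matrix.
  have e2 : (P - (1 / 2 : ℂ) • 1) * (P - (1 / 2 : ℂ) • 1)ᴴ = P * P - P + (1 / 4 : ℂ) • 1 := by
    rw [Matrix.conjTranspose_sub, hPH, Matrix.conjTranspose_smul, Matrix.conjTranspose_one]
    have : star (1 / 2 : ℂ) = 1 / 2 := by simp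
    rw [this]
    simp only [mul_sub, sub_mul, mul_smul_comm, smul_mul_assoc, mul_one, one_mul]
    module
  have h3 : ((∑ i, ∑ j, ‖(u * vᵀ) i j‖ ^ 2 +
      ∑ i, ∑ j, ‖(P - (1 / 2 : ℂ) • 1) i j‖ ^ 2 : ℝ) : ℂ) = ((L / 4 : ℝ) : ℂ) := by
    rw [Complex.ofReal_add, frob, frob, e1, e2, ← Matrix.trace_add]
    simp [Matrix.trace_smul]
    ring
  have h4 := Complex.ofReal_injective h3
  have h5 : 0 ≤ ∑ i, ∑ j, ‖(P - (1 / 2 : ℂ) • 1) i j‖ ^ 2 :=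
    Finset.sum_nonneg fun _ _ => Finset.sum_nonneg fun _ _ => by positivity
  linarith

/-! ### Pair expansion of the number operator on a vacuum -/

section Vacuum

variable {ψ : Fock L}

/-- Applying the number operator to a quasiparticle vacuum creates pairs of quasiparticles. -/
lemma numberOp_apply (H : IsCAR u v) (hψ : ∀ i, quasiparticle u v i ψ = 0) :
    numberOp L ψ = ((∑ i, ∑ j, ‖v i j‖ ^ 2 : ℝ) : ℂ) • ψ +
      ∑ i, ∑ k, (u * vᵀ) i k • star (quasiparticle u v i) (star (quasiparticle u v k) ψ) := by
  have h1 : ∀ j, (creation j * annihilation j) ψ =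
      (∑ i, v i j * star (v i j)) • ψ +
      ∑ i, ∑ k, (u i j * v k j) •
        star (quasiparticle u v i) (star (quasiparticle u v k) ψ) := by
    intro j
    have ha : annihilation j ψ = ∑ k, v k j • star (quasiparticle u v k) ψ := by
      rw [H.annihilation_eq j]
      simp [LinearMap.sum_apply, hψ]
    rw [Module.End.mul_apply, ha, H.creation_eq j]
    -- Moving `d_i` past `d†_k` to ψ leaves only the contraction `i = k`, the source of the
    -- constant.
    simp only [LinearMap.sum_apply, LinearMap.add_apply, LinearMap.smul_apply, map_sum, map_smul,
      H.apply_star_apply, hψ, map_zero, sub_zero, smul_add, Finset.sum_add_distrib]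
    rw [add_comm]
    congr 1
    · simp [Finset.sum_smul, smul_smul]
    · rw [Finset.sum_comm]
      simp [Finset.smul_sum, smul_smul, mul_comm]
  have h2 : numberOp L ψ = ∑ j, (creation j * annihilation j) ψ := by
    simp [numberOp, LinearMap.sum_apply]
  rw [h2, Finset.sum_congr rfl fun j _ => h1 j, Finset.sum_add_distrib]
  congr 1
  · rw [← Finset.sum_smul, Finset.sum_comm]
    simp [Complex.mul_conj']
  · rw [Finset.sum_comm]
    refine Finset.sum_congr rfl fun i _ => ?_
    rw [Finset.sum_comm]
    refine Finset.sum_congr rfl fun k _ => ?_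
    rw [← Finset.sum_smul]
    simp [Matrix.mul_apply]

lemma inner_star_left (A : Module.End ℂ (Fock L)) (x y : Fock L) :
    inner ℂ (star A x) y = inner ℂ x (A y) :=
  LinearMap.adjoint_inner_left A y x

/-- Wick's rule: the two ways of contracting the pairs enter with opposite signs. -/
lemma inner_pair (H : IsCAR u v) (hnorm : ‖ψ‖ = 1) (hψ : ∀ i, quasiparticle u v i ψ = 0)
    (i k l m : Fin L) :
    inner ℂ (star (quasiparticle u v i) (star (quasiparticle u v k) ψ))
      (star (quasiparticle u v l) (star (quasiparticle u v m) ψ)) =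
      (if i = l then if k = m then (1 : ℂ) else 0 else 0) -
        (if i = m then if k = l then 1 else 0 else 0) := by
  have hn : inner ℂ ψ ψ = (1 : ℂ) := by rw [inner_self_eq_norm_sq_to_K, hnorm]; simp
  rw [inner_star_left, inner_star_left, H.apply_star_apply, H.apply_star_apply, hψ, map_zero,
    sub_zero, map_sub]
  by_cases h1 : i = l <;> by_cases h2 : i = m <;> by_cases h3 : k = m <;> by_cases h4 : k = l <;>
    simp [h1, h2, h3, h4, H.apply_star_apply, hψ] <;> simp_all

lemma inner_vacuum_star (hψ : ∀ i, quasiparticle u v i ψ = 0) (i : Fin L) (x : Fock L) :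
    inner ℂ ψ (star (quasiparticle u v i) x) = (0 : ℂ) := by
  rw [show inner ℂ ψ (star (quasiparticle u v i) x) = inner ℂ (quasiparticle u v i ψ) x from
    LinearMap.adjoint_inner_right _ _ _, hψ, inner_zero_left]

/-- The factor 2 arises because antisymmetry of `u vᵀ` makes both contractions contribute equally.
-/
lemma norm_sum_pair_sq (H : IsCAR u v) (hnorm : ‖ψ‖ = 1)
    (hψ : ∀ i, quasiparticle u v i ψ = 0) :
    ‖∑ i, ∑ k, (u * vᵀ) i k • star (quasiparticle u v i) (star (quasiparticle u v k) ψ)‖ ^ 2 =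
      2 * ∑ i, ∑ k, ‖(u * vᵀ) i k‖ ^ 2 := by
  have hanti : ∀ i k, (u * vᵀ) k i = -(u * vᵀ) i k := by
    intro i k
    have := congrFun (congrFun H.mul_transpose i) k
    rw [Matrix.add_apply, Matrix.zero_apply] at this
    rw [← add_eq_zero_iff_eq_neg, ← this, add_comm]
    congr 1
    simp [Matrix.mul_apply, mul_comm]
  generalize u * vᵀ = A at hanti
  apply Complex.ofReal_injective
  have h0 := inner_self_eq_norm_sq_to_K (𝕜 := ℂ)
    (∑ i, ∑ k, A i k • star (quasiparticle u v i) (star (quasiparticle u v k) ψ))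
  rw [Complex.ofReal_pow]
  refine h0.symm.trans ?_
  simp only [sum_inner, inner_sum, inner_smul_left, inner_smul_right, H.inner_pair hnorm hψ]
  have h1 : ∀ i k, ∑ l, ∑ m, A i k * (starRingEnd ℂ (A l m) *
      ((if l = i then if m = k then (1 : ℂ) else 0 else 0) -
        (if l = k then if m = i then 1 else 0 else 0))) = 2 * (‖A i k‖ : ℂ) ^ 2 := by
    intro i k
    have e : ∀ p q, ∑ l, ∑ m, A i k * (starRingEnd ℂ (A l m) *
        (if l = p then if m = q then (1 : ℂ) else 0 else 0)) =
          A i k * starRingEnd ℂ (A p q) := by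
      intro p q
      simp [mul_ite, Finset.sum_ite_irrel]
    simp only [mul_sub, Finset.sum_sub_distrib]
    rw [e, e, hanti i k, map_neg, mul_neg, Complex.mul_conj']
    ring
  push_cast
  simp only [Finset.mul_sum]
  exact Finset.sum_congr rfl fun i _ => Finset.sum_congr rfl fun k _ => h1 i k

end Vacuum

end IsCAR

/-! ### Variance bound for a vacuum -/

lemma star_numberOp : star (numberOp L) = numberOp L := by
  simp [numberOp, star_sum, star_annihilation, star_creation]

/-- The centred number operator is self-adjoint, so one of its two factors moves to the other side
of the inner product. -/
lemma numberVariance_eq (ψ : Fock L) :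
    numberVariance ψ =
      ‖numberOp L ψ - ((expectation (numberOp L) ψ : ℝ) : ℂ) • ψ‖ ^ 2 := by
  unfold numberVariance
  generalize expectation (numberOp L) ψ = n
  set M := numberOp L - (n : ℂ) • (1 : Module.End ℂ (Fock L)) with hM
  have hs : star M = M := by
    simp [hM, star_numberOp]
  have hM' : M ψ = numberOp L ψ - (n : ℂ) • ψ := by simp [hM]
  rw [← hM', expectation, pow_two, Module.End.mul_apply]
  nth_rw 1 [← hs]
  rw [show inner ℂ ψ (star M (M ψ)) = inner ℂ (M ψ) (M ψ) from
    LinearMap.adjoint_inner_right _ _ _]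
  exact inner_self_eq_norm_sq (𝕜 := ℂ) (M ψ)

/-- The particle number variance of a normalized quasiparticle vacuum is at most `L / 2`. -/
lemma IsCAR.numberVariance_le {u v : Matrix (Fin L) (Fin L) ℂ} (H : IsCAR u v) {ψ : Fock L}
    (hnorm : ‖ψ‖ = 1) (hψ : ∀ i, quasiparticle u v i ψ = 0) :
    numberVariance ψ ≤ (L : ℝ) / 2 := by
  have hn : inner ℂ ψ ψ = (1 : ℂ) := by rw [inner_self_eq_norm_sq_to_K, hnorm]; simp
  have hexp : expectation (numberOp L) ψ = ∑ i, ∑ j, ‖v i j‖ ^ 2 := by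
    rw [expectation, H.numberOp_apply hψ, inner_add_right, inner_smul_right, hn, mul_one]
    simp only [inner_sum, inner_smul_right, inner_vacuum_star hψ, mul_zero, Finset.sum_const_zero,
      add_zero, Complex.ofReal_re]
  rw [numberVariance_eq, hexp, H.numberOp_apply hψ, add_sub_cancel_left,
    H.norm_sum_pair_sq hnorm hψ]
  have := H.sum_norm_mul_transpose_sq_le
  linarith

/-! ### Exchange of `d_a` and `d†_a` -/

/-- Exchanging the roles of `d_a` and `d†_a` gives another set of quasiparticle operators. -/
lemma quasiparticle_update (u v : Matrix (Fin L) (Fin L) ℂ) (a i : Fin L) :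
    quasiparticle (u.updateRow a fun j => star (v a j))
        (v.updateRow a fun j => star (u a j)) i =
      if i = a then star (quasiparticle u v a) else quasiparticle u v i := by
  split_ifs with h
  · subst h
    rw [star_quasiparticle]
    simp [quasiparticle]
  · simp [quasiparticle, Matrix.updateRow_ne h]

lemma IsCAR.update {u v : Matrix (Fin L) (Fin L) ℂ} (H : IsCAR u v) (a : Fin L) :
    IsCAR (u.updateRow a fun j => star (v a j))
      (v.updateRow a fun j => star (u a j)) := by
  have hss : ∀ i j, star (quasiparticle u v i) * star (quasiparticle u v j) +
      star (quasiparticle u v j) * star (quasiparticle u v i) = 0 := by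
    intro i j
    have := congrArg star (H.anticomm j i)
    simpa using this
  have hs : ∀ i j, star (quasiparticle u v j) * quasiparticle u v i +
      quasiparticle u v i * star (quasiparticle u v j) = if i = j then 1 else 0 := by
    intro i j
    rw [add_comm, H.anticomm_star]
  constructor
  · intro i j
    simp only [quasiparticle_update]
    by_cases hi : i = a <;> by_cases hj : j = a
    · simp [hi, hj, hss]
    · simp [hi, hj, hs]
    · simp [hi, hj, H.anticomm_star]
    · simp [hi, hj, H.anticomm]
  · intro i j
    simp only [quasiparticle_update]
    by_cases hi : i = a <;> by_cases hj : j = a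
    · simp [hi, hj, hs]
    · simp [hi, hj, hss, Ne.symm hj]
    · simp [hi, hj, H.anticomm]
    · simp [hi, hj, H.anticomm_star]

lemma IsCAR.star_apply_star_apply {u v : Matrix (Fin L) (Fin L) ℂ} (H : IsCAR u v) (a : Fin L)
    (x : Fock L) : star (quasiparticle u v a) (star (quasiparticle u v a) x) = 0 := by
  have := congrArg (fun A : Module.End ℂ (Fock L) => (star A) x) (H.anticomm a a)
  simp only [star_add, star_mul, LinearMap.add_apply, Module.End.mul_apply, star_zero,
    LinearMap.zero_apply] at this
  rwa [← two_smul ℂ, smul_eq_zero_iff_right two_ne_zero] at this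

lemma IsCAR.norm_star_apply {u v : Matrix (Fin L) (Fin L) ℂ} (H : IsCAR u v) {ψ : Fock L}
    (hψ : ∀ i, quasiparticle u v i ψ = 0) (a : Fin L) :
    ‖star (quasiparticle u v a) ψ‖ = ‖ψ‖ := by
  have h : inner ℂ (star (quasiparticle u v a) ψ) (star (quasiparticle u v a) ψ) =
      (inner ℂ ψ ψ : ℂ) := by
    rw [inner_star_left, H.apply_star_apply, hψ, map_zero, if_pos rfl, sub_zero]
  rw [@norm_eq_sqrt_re_inner ℂ, h, ← norm_eq_sqrt_re_inner]

/-- The new operator at `a` kills the state since `(d†_a)² = 0`; the others anticommute past `d†_a`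
and reach ψ. -/
lemma IsCAR.update_apply_star_apply {u v : Matrix (Fin L) (Fin L) ℂ} (H : IsCAR u v)
    {ψ : Fock L} (hψ : ∀ i, quasiparticle u v i ψ = 0) (a i : Fin L) :
    quasiparticle (u.updateRow a fun j => star (v a j))
        (v.updateRow a fun j => star (u a j)) i (star (quasiparticle u v a) ψ) = 0 := by
  rw [quasiparticle_update]
  split_ifs with h
  · exact H.star_apply_star_apply a ψ
  · rw [H.apply_star_apply, hψ, map_zero, if_neg h, sub_zero]

lemma IsDiagonalizedBy.isCAR {h Δ u v : Matrix (Fin L) (Fin L) ℂ} {E : Fin L → ℝ}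
    (hd : IsDiagonalizedBy h Δ u v E) : IsCAR u v :=
  ⟨hd.anticomm, hd.anticomm_adjoint⟩

end MeanFieldSC

theorem mainTheorem5 (L : ℕ) (hL : Even L) (h Δ : Matrix (Fin L) (Fin L) ℂ)
    (hh : h.IsHermitian) (u v : Matrix (Fin L) (Fin L) ℂ) (E : Fin L → ℝ)
    (hd : MeanFieldSC.IsDiagonalizedBy h Δ u v E)
    (plus : MeanFieldSC.Fock L) (hnorm : ‖plus‖ = 1)
    (hplus : ∀ i, MeanFieldSC.quasiparticle u v i plus = 0) :
    MeanFieldSC.numberVariance plus ≤ (L : ℝ) / 2 ∧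
      ∀ i₁ : Fin L, (∀ i, E i₁ ≤ E i) →
        ‖LinearMap.adjoint (MeanFieldSC.quasiparticle u v i₁) plus‖ = 1 ∧
          MeanFieldSC.numberVariance
            (LinearMap.adjoint (MeanFieldSC.quasiparticle u v i₁) plus) ≤ (L : ℝ) / 2 + 8 := by
  have H := hd.isCAR
  refine ⟨H.numberVariance_le hnorm hplus, fun a _ => ?_⟩
  have hn : ‖LinearMap.adjoint (MeanFieldSC.quasiparticle u v a) plus‖ = 1 :=
    (H.norm_star_apply hplus a).trans hnorm
  refine ⟨hn, ?_⟩
  -- This already gives `L/2`; the additional 8 is slack.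
  have := (H.update a).numberVariance_le hn (H.update_apply_star_apply hplus a)
  linarith
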